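/- Let $H$ be a separable real Hilbert space (possibly finite-dimensional) with inner product $g$, and let $(g,J,\omega)$ be a compatible triple: $J$ is a bounded operator with $J^2=-1$, $\omega$ is a strong symplectic form (a bounded antisymmetric bilinear form such that $v\mapsto\omega(v,\cdot)$ is an isomorphism $H\to H^*$), and $g(v,w)=\omega(v,Jw)$ for all $v,w\in H$. Let $H_{\mathbb C}=H\otimes_{\mathbb R}\mathbb C$ be the complexification, a complex Hilbert space with the sesquilinear extension of $g$, let $\alpha$ be complex conjugation on $H_{\mathbb C}$, extend $J$ complex linearly, and put $L^+=\ker(J-i)$. Let $\mathrm{Pol}^g(H)$ be the set of closed complex subspaces $W\subset H_{\mathbb C}$ such that $H_{\mathbb C}=W\oplus\alpha(W)$ is an orthogonal direct sum, and let the restricted orthogonal Grassmannian $\mathrm{Pol}^g_2(H)$ be the set of those $W\in\mathrm{Pol}^g(H)$ for which the orthogonal projection $L^+\to\alpha(W)$ is Hilbert–Schmidt. Let $(e_k)_{k\in I}$ be an orthonormal basis of $L^+$ indexed by a set $I$ of positive integers ($I=\{1,2,\dots\}$ if $L^+$ is infinite-dimensional, and for instance $I=\{1,\dots,n\}$ if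 $\dim L^+=n$), and put $e_{-k}=\alpha e_k$. For a finite set $S\subset I$ let $W_S$ be the closed linear span of $\{e_k : k\in I\setminus S\}\cup\{e_{-l} : l\in S\}$. Let $\mathcal B_2^\alpha(W_S,W_S^\perp)$ be the space, with the Hilbert–Schmidt norm, of Hilbert–Schmidt operators $Z:W_S\to W_S^\perp$ such that $\alpha Z\alpha=-Z^*$ as operators $W_S^\perp\to W_S$. Put $\mathrm{graph}(Z)=\{x+Zx : x\in W_S\}$ and $$\mathcal O_S=\{\mathrm{graph}(Z)\in\mathrm{Pol}^g_2(H) : Z\in\mathcal B_2^\alpha(W_S,W_S^\perp)\}.$$ Then: 1. for every $W\in\mathrm{Pol}^g_2(H)$ there are a finite set $S\subset I$ and $Z\in\mathcal B_2^\alpha(W_S,W_S^\perp)$ with $W=\mathrm{graph}(Z)$; 2. consequently $\bigcup_S\mathcal O_S=\mathrm{Pol}^g_2(H)$, the union being over all finite $S\subset I$; 3. the sets $\mathcal O_S$ serve as chart domains: for every finite $S\subset I$ the map $Z\mapsto\mathrm{graph}(Z)$ is a bijection from $\mathcal B_2^\alpha(W_S,W_S^\perp)$ onto $\mathcal O_S$,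 and for all finite $S,T\subset I$ the set $\{Z\in\mathcal B_2^\alpha(W_S,W_S^\perp) : \mathrm{graph}(Z)\in\mathcal O_T\}$ is open in $\mathcal B_2^\alpha(W_S,W_S^\perp)$ for the Hilbert–Schmidt norm. -/

import Mathlib

open scoped ENNReal InnerProductSpace

noncomputable section

namespace RestrictedGrassmannian

/-! ### The complexification of a real Hilbert space -/

section Complexification

variable {H : Type*} [NormedAddCommGroup H]

/-- The complexification `H ⊗ ℂ` of a real inner product space: pairs `(x, y)`, standing for
`x + i y`, with the norm `‖x + i y‖² = ‖x‖² + ‖y‖²`. -/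
def Complexification (H : Type*) [NormedAddCommGroup H] : Type _ := WithLp 2 (H × H)

instance : NormedAddCommGroup (Complexification H) :=
  inferInstanceAs (NormedAddCommGroup (WithLp 2 (H × H)))

instance [CompleteSpace H] : CompleteSpace (Complexification H) :=
  inferInstanceAs (CompleteSpace (WithLp 2 (H × H)))

namespace Complexification

/-- The vector `x + i y`. -/
def mk (x y : H) : Complexification H := WithLp.toLp 2 (x, y)

/-- The real part of a vector. -/
def re (v : Complexification H) : H := (WithLp.ofLp v).1

/-- The imaginary part of a vector. -/
def im (v : Complexification H) : H := (WithLp.ofLp v).2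

@[ext] theorem ext {v w : Complexification H} (h₁ : re v = re w) (h₂ : im v = im w) : v = w :=
  WithLp.ofLp_injective 2 (Prod.ext h₁ h₂)

@[simp] theorem re_mk (x y : H) : re (mk x y) = x := rfl
@[simp] theorem im_mk (x y : H) : im (mk x y) = y := rfl
@[simp] theorem re_add (v w : Complexification H) : re (v + w) = re v + re w := rfl
@[simp] theorem im_add (v w : Complexification H) : im (v + w) = im v + im w := rfl
@[simp] theorem re_zero : re (0 : Complexification H) = 0 := rfl
@[simp] theorem im_zero : im (0 : Complexification H) = 0 := rfl

theorem norm_sq_eq (v : Complexification H) : ‖v‖ ^ 2 = ‖re v‖ ^ 2 + ‖im v‖ ^ 2 :=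
  WithLp.prod_norm_sq_eq_of_L2 (α := H) (β := H) v

variable [InnerProductSpace ℝ H]

/-- `(a + i b) (x + i y) = (a x - b y) + i (a y + b x)`. -/
instance : SMul ℂ (Complexification H) :=
  ⟨fun z v => mk (z.re • re v - z.im • im v) (z.re • im v + z.im • re v)⟩

@[simp] theorem re_smul (z : ℂ) (v : Complexification H) :
    re (z • v) = z.re • re v - z.im • im v := rfl
@[simp] theorem im_smul (z : ℂ) (v : Complexification H) :
    im (z • v) = z.re • im v + z.im • re v := rfl

instance : Module ℂ (Complexification H) where
  one_smul v := by ext <;> simp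
  mul_smul z w v := by
    ext <;> simp only [re_smul, im_smul, Complex.mul_re, Complex.mul_im] <;> module
  smul_zero z := by ext <;> simp
  smul_add z v w := by
    ext <;> simp only [re_smul, im_smul, re_add, im_add] <;> module
  add_smul z w v := by
    ext <;> simp only [re_smul, im_smul, re_add, im_add, Complex.add_re, Complex.add_im] <;> module
  zero_smul v := by ext <;> simp

/-- The sesquilinear extension of the inner product of `H`. As everywhere in Mathlib the form
`inner ℂ v w` is conjugate linear in `v` and linear in `w`. -/
instance : Inner ℂ (Complexification H) :=
  ⟨fun v w => ⟨⟪re v, re w⟫_ℝ + ⟪im v, im w⟫_ℝ, ⟪re v, im w⟫_ℝ - ⟪im v, re w⟫_ℝ⟩⟩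

theorem inner_def (v w : Complexification H) :
    inner ℂ v w = ⟨⟪re v, re w⟫_ℝ + ⟪im v, im w⟫_ℝ, ⟪re v, im w⟫_ℝ - ⟪im v, re w⟫_ℝ⟩ := rfl

theorem norm_smul_eq (z : ℂ) (v : Complexification H) : ‖z • v‖ = ‖z‖ * ‖v‖ := by
  have h : ‖z • v‖ ^ 2 = (‖z‖ * ‖v‖) ^ 2 := by
    rw [norm_sq_eq, mul_pow, norm_sq_eq, ← Complex.normSq_eq_norm_sq, Complex.normSq_apply,
      re_smul, im_smul, norm_sub_sq_real, norm_add_sq_real]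
    simp only [norm_smul, mul_pow, Real.norm_eq_abs, sq_abs, real_inner_smul_left,
      real_inner_smul_right, real_inner_comm (re v) (im v)]
    ring
  exact (sq_eq_sq₀ (norm_nonneg _) (by positivity)).1 h

instance : NormedSpace ℂ (Complexification H) where
  norm_smul_le z v := (norm_smul_eq z v).le

instance : InnerProductSpace ℂ (Complexification H) where
  norm_sq_eq_re_inner v := by
    rw [norm_sq_eq, inner_def]
    simp
  conj_inner_symm v w := by
    apply Complex.ext <;> simp [inner_def, real_inner_comm]
  add_left u v w := by
    apply Complex.ext <;> simp [inner_def, inner_add_left] <;> ring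
  smul_left v w z := by
    apply Complex.ext <;>
      simp [inner_def, inner_sub_left, inner_add_left, real_inner_smul_left] <;> ring

/-- The real structure `α`, i.e. `α (x + i y) = x - i y`, a conjugate-linear isometric involution. -/
def conj : Complexification H ≃ₗᵢ⋆[ℂ] Complexification H where
  toFun v := mk (re v) (-im v)
  invFun v := mk (re v) (-im v)
  map_add' v w := by ext <;> simp [add_comm]
  map_smul' z v := by ext <;> simp [add_comm]
  left_inv v := by ext <;> simp
  right_inv v := by ext <;> simp
  norm_map' v := by
    refine (sq_eq_sq₀ (norm_nonneg _) (norm_nonneg _)).1 ?_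
    simp [norm_sq_eq]

/-- The complex-linear extension of a bounded operator on `H`. -/
def extend (T : H →L[ℝ] H) : Complexification H →L[ℂ] Complexification H where
  toFun v := mk (T (re v)) (T (im v))
  map_add' v w := by ext <;> simp
  map_smul' z v := by ext <;> simp
  cont := by
    change Continuous fun v : WithLp 2 (H × H) => WithLp.toLp 2 (T v.fst, T v.snd)
    fun_prop

end Complexification

end Complexification

/-! ### Hilbert–Schmidt operators -/

section HilbertSchmidt

variable {E F : Type*} [NormedAddCommGroup E] [InnerProductSpace ℂ E]
  [NormedAddCommGroup F] [InnerProductSpace ℂ F]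

/-- The Hilbert–Schmidt norm `(∑ ‖T b‖²)^(1/2)` in `[0, ∞]`, the sum being over an orthonormal basis
of the domain; it does not depend on the basis, see `hsNorm_eq`. -/
def hsNorm [CompleteSpace E] (T : E →L[ℂ] F) : ℝ≥0∞ :=
  (∑' x : (exists_hilbertBasis ℂ E).choose, ‖T (x : E)‖ₑ ^ 2) ^ (1 / 2 : ℝ)

/-- A bounded operator is Hilbert–Schmidt if its Hilbert–Schmidt norm is finite. -/
def IsHilbertSchmidt [CompleteSpace E] (T : E →L[ℂ] F) : Prop := hsNorm T < ∞

theorem tsum_enorm_inner_sq {ι : Type*} (b : HilbertBasis ι ℂ E) (x : E) :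
    ∑' i, ‖inner ℂ (b i) x‖ₑ ^ 2 = ‖x‖ₑ ^ 2 := by
  have h : HasSum (fun i => ‖inner ℂ (b i) x‖ ^ 2) (‖x‖ ^ 2) := by
    have h₁ := lp.hasSum_norm (p := 2) (by norm_num) (b.repr x)
    simpa [b.repr_apply_apply] using h₁
  have h₂ := ENNReal.ofReal_tsum_of_nonneg (fun i => sq_nonneg _) h.summable
  rw [h.tsum_eq] at h₂
  simpa [ENNReal.ofReal_pow] using h₂.symm

theorem tsum_enorm_sq_adjoint [CompleteSpace E] [CompleteSpace F] {ι κ : Type*}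
    (b : HilbertBasis ι ℂ E) (c : HilbertBasis κ ℂ F) (T : E →L[ℂ] F) :
    ∑' i, ‖T (b i)‖ₑ ^ 2 = ∑' j, ‖ContinuousLinearMap.adjoint T (c j)‖ₑ ^ 2 := by
  simp_rw [← tsum_enorm_inner_sq c (T _), ← tsum_enorm_inner_sq b (ContinuousLinearMap.adjoint T _)]
  rw [ENNReal.tsum_comm]
  refine tsum_congr fun j => tsum_congr fun i => ?_
  rw [ContinuousLinearMap.adjoint_inner_right, ← inner_conj_symm, RCLike.enorm_conj]

/-- The Hilbert–Schmidt norm can be computed in every orthonormal basis. -/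
theorem hsNorm_eq [CompleteSpace E] [CompleteSpace F] {ι : Type*}
    (b : HilbertBasis ι ℂ E) (T : E →L[ℂ] F) :
    hsNorm T = (∑' i, ‖T (b i)‖ₑ ^ 2) ^ (1 / 2 : ℝ) := by
  obtain ⟨w, c, -⟩ := exists_hilbertBasis ℂ F
  obtain ⟨b₀, hb₀⟩ := (exists_hilbertBasis ℂ E).choose_spec
  rw [hsNorm, tsum_enorm_sq_adjoint b c, ← tsum_enorm_sq_adjoint b₀ c, hb₀]

end HilbertSchmidt

/-! ### Compatible triples, polarizations, and the restricted Grassmannian -/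

section Grassmannian

open Complexification

variable {H : Type*} [NormedAddCommGroup H] [InnerProductSpace ℝ H] [CompleteSpace H]

/-- `(g, J, ω)` is a compatible triple, where `g` is the inner product of the Hilbert space `H`:
`J` is a complex structure, `ω` is a strong symplectic form, and `g (v, w) = ω (v, J w)`. -/
structure IsCompatibleTriple (J : H →L[ℝ] H) (ω : H →L[ℝ] H →L[ℝ] ℝ) : Prop where
  sq_eq : ∀ v, J (J v) = -v
  skew : ∀ v w, ω v w = -ω w v
  strong : Function.Bijective ω
  compat : ∀ v w, ⟪v, w⟫_ℝ = ω v (J w)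

/-- `L⁺ = ker (J - i)`. -/
def Lplus (J : H →L[ℝ] H) : Submodule ℂ (Complexification H) :=
  (extend J - Complex.I • ContinuousLinearMap.id ℂ (Complexification H)).ker

instance (J : H →L[ℝ] H) : CompleteSpace (Lplus J) :=
  (ContinuousLinearMap.isClosed_ker
    (extend J - Complex.I • ContinuousLinearMap.id ℂ (Complexification H))).completeSpace_coe

/-- The image `α (W)` of a complex subspace under the real structure. -/
def conjImage (W : Submodule ℂ (Complexification H)) : Submodule ℂ (Complexification H) :=
  W.map (conj (H := H)).toLinearEquiv.toLinearMap

/-- `Pol^g (H)`: the closed subspaces `W` such that `H_ℂ = W ⊕ α (W)` is an orthogonal direct sum. -/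
def PolG (H : Type*) [NormedAddCommGroup H] [InnerProductSpace ℝ H] [CompleteSpace H] :
    Set (Submodule ℂ (Complexification H)) :=
  {W | IsClosed (W : Set (Complexification H)) ∧ W ⟂ conjImage W ∧ IsCompl W (conjImage W)}

/-- `Pol^g_2 (H)`: the `W` in `Pol^g (H)` for which the orthogonal projection `L⁺ → α (W)` is
Hilbert–Schmidt. (The orthogonal projection onto `α (W)` exists because `α (W)` is closed.) -/
def PolG₂ (J : H →L[ℝ] H) : Set (Submodule ℂ (Complexification H)) :=
  {W | W ∈ PolG H ∧ ∃ _ : (conjImage W).HasOrthogonalProjection,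
    IsHilbertSchmidt ((conjImage W).orthogonalProjectionOnto ∘L (Lplus J).subtypeL)}

/-- For an orthonormal basis `(e k)` of `L⁺`, with `e (-k) = α (e k)`, and a finite set `S` of
indices, `W_S` is the closed linear span of the `e k` with `k ∉ S` and the `e (-l)` with `l ∈ S`. -/
def WS {J : H →L[ℝ] H} {I : Set ℕ+} (e : HilbertBasis I ℂ (Lplus J)) (S : Finset I) :
    Submodule ℂ (Complexification H) :=
  (Submodule.span ℂ ({v | ∃ k, k ∉ S ∧ v = (e k : Complexification H)} ∪
    {v | ∃ l, l ∈ S ∧ v = conj (e l : Complexification H)})).topologicalClosure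

instance {J : H →L[ℝ] H} {I : Set ℕ+} (e : HilbertBasis I ℂ (Lplus J)) (S : Finset I) :
    CompleteSpace (WS e S) :=
  inferInstanceAs (CompleteSpace (Submodule.topologicalClosure _))

/-- `𝓑₂^α (W, W^⊥)`: the Hilbert–Schmidt operators `Z : W → W^⊥` with `α Z α = - Z^*` as operators
from `W^⊥` to `W`; this presupposes that `α` maps `W^⊥` into `W`. -/
def B₂α (W : Submodule ℂ (Complexification H)) [CompleteSpace W] : Set (W →L[ℂ] Wᗮ) :=
  {Z | IsHilbertSchmidt Z ∧ ∃ h : ∀ x : Wᗮ, conj (x : Complexification H) ∈ W,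
    ∀ x : Wᗮ, conj (Z ⟨conj (x : Complexification H), h x⟩ : Complexification H) =
      -(ContinuousLinearMap.adjoint Z x : Complexification H)}

/-- The graph `{x + Z x | x ∈ W}` of an operator `Z : W → W^⊥`, as a subspace of `H_ℂ`. -/
def graph {W : Submodule ℂ (Complexification H)} (Z : W →L[ℂ] Wᗮ) :
    Submodule ℂ (Complexification H) :=
  (W.subtypeL + Wᗮ.subtypeL ∘L Z).range

/-- `𝒪_S`: the elements of `Pol^g_2 (H)` that are graphs of operators in `𝓑₂^α (W_S, W_S^⊥)`. -/
def OS {J : H →L[ℝ] H} {I : Set ℕ+} (e : HilbertBasis I ℂ (Lplus J)) (S : Finset I) :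
    Set (Submodule ℂ (Complexification H)) :=
  {W | W ∈ PolG₂ J ∧ ∃ Z ∈ B₂α (WS e S), W = graph Z}

end Grassmannian

end RestrictedGrassmannian

end

/-! Write `P_K` for the orthogonal projection onto `K`. Membership of `W` in `Pol^g` means that `W`
is closed and `α(W) = W^⊥`. Since `W_S` and `L⁺` have orthonormal bases differing in finitely many
vectors, the restricted condition says equally that `P_{W^⊥}` is Hilbert–Schmidt on any `W_S`, hence
compact there.

Put `U = W_S`. If `W ∩ U^⊥ = 0`, applying `α` gives `U ∩ W^⊥ = 0`. The Fredholm alternative for `1 -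
P_U P_{W^⊥}` on `U` then makes `P_U : W → U` invertible, so `W` is a graph (`exists_eq_graph`).
Orthogonality of `W` and `α(W)` is the symmetry `α Z α = -Z^*`, and `‖Z x‖` is comparable to
`‖P_{W^⊥} x‖`, so `Z` is Hilbert–Schmidt (`exists_mem_B₂α_eq_graph`).

It remains to choose `S` with `W ∩ W_S^⊥ = 0` (`exists_inf_WS_orthogonal_eq_bot`). By compactness `M
= L⁺ ∩ W^⊥` is finite-dimensional, and `S` is chosen so that the coordinate functionals `⟨e k, ·⟩`,
`k ∈ S`, form a basis of the span of all of them on `M`. Independence forces a vector of `W ∩ W_S^⊥`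
to be orthogonal to `L⁺`, and spanning forces it to be orthogonal to `α(L⁺)`.

Openness holds because transversality to `W_T^⊥` survives small perturbations in operator norm,
which the Hilbert–Schmidt norm dominates. -/

namespace RestrictedGrassmannian

/-! ### Hilbert–Schmidt operators: norm comparison and compactness. -/

section HilbertSchmidt

variable {E F : Type*} [NormedAddCommGroup E] [InnerProductSpace ℂ E] [CompleteSpace E]
  [NormedAddCommGroup F] [InnerProductSpace ℂ F] [CompleteSpace F]

theorem hsNorm_sq_eq {ι : Type*} (b : HilbertBasis ι ℂ E) (T : E →L[ℂ] F) :
    hsNorm T ^ 2 = ∑' i, ‖T (b i)‖ₑ ^ 2 := by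
  rw [hsNorm_eq b, ← ENNReal.rpow_natCast, ← ENNReal.rpow_mul]
  norm_num

theorem isHilbertSchmidt_iff {ι : Type*} (b : HilbertBasis ι ℂ E) (T : E →L[ℂ] F) :
    IsHilbertSchmidt T ↔ ∑' i, ‖T (b i)‖ₑ ^ 2 < ∞ := by
  rw [← hsNorm_sq_eq b, IsHilbertSchmidt]
  simp [lt_top_iff_ne_top]

/-- Any unit vector extends to an orthonormal basis, and the Hilbert–Schmidt norm may be computed in
that basis. -/
theorem enorm_le_hsNorm (T : E →L[ℂ] F) : ‖T‖ₑ ≤ hsNorm T := by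
  by_cases hT : hsNorm T = ∞
  · simp [hT]
  have key : ∀ x : E, ‖x‖ = 1 → ‖T x‖ₑ ≤ hsNorm T := by
    intro x hx
    have ho : Orthonormal ℂ ((↑) : ({x} : Set E) → E) := by
      refine ⟨fun i => ?_, fun i j hij => (hij (Subsingleton.elim i j)).elim⟩
      obtain ⟨i, rfl⟩ := i
      exact hx
    obtain ⟨w, b, hw, hb⟩ := ho.exists_hilbertBasis_extension
    have h : ‖T x‖ₑ ^ 2 ≤ hsNorm T ^ 2 := by
      rw [hsNorm_sq_eq b]
      have := ENNReal.le_tsum (f := fun i => ‖T (b i)‖ₑ ^ 2) ⟨x, hw rfl⟩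
      simpa [hb] using this
    exact (ENNReal.pow_le_pow_left_iff two_ne_zero).1 h
  have : ‖T‖ ≤ (hsNorm T).toReal := by
    refine T.opNorm_le_of_unit_norm (𝕜 := ℂ) ENNReal.toReal_nonneg fun x hx => ?_
    have := ENNReal.toReal_mono hT (key x hx)
    simpa using this
  rw [← ofReal_norm]
  exact ENNReal.ofReal_le_of_le_toReal this

theorem IsHilbertSchmidt.isCompactOperator {T : E →L[ℂ] F} (hT : IsHilbertSchmidt T) :
    IsCompactOperator T := by
  classical
  obtain ⟨w, b, -⟩ := exists_hilbertBasis ℂ E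
  rw [isHilbertSchmidt_iff b] at hT
  -- Finite-rank truncations of `T`; the squared Hilbert–Schmidt norm of `T - R s` is a tail of a
  -- convergent sum.
  let R : Finset w → E →L[ℂ] F := fun s => ∑ i ∈ s, (innerSL ℂ (b i)).smulRight (T (b i))
  have hR : ∀ s i, (T - R s) (b i) = if i ∈ s then 0 else T (b i) := by
    intro s i
    have : R s (b i) = if i ∈ s then T (b i) else 0 := by
      simp [R, orthonormal_iff_ite.1 b.orthonormal, ite_smul]
    rw [sub_apply, this]
    split_ifs <;> simp
  have hsum : ∀ s, hsNorm (T - R s) ^ 2 = ∑' i : { i // i ∉ s }, ‖T (b i)‖ₑ ^ 2 := by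
    intro s
    rw [hsNorm_sq_eq b]
    refine Eq.trans ?_ (tsum_subtype {i | i ∉ s} fun i => ‖T (b i)‖ₑ ^ 2).symm
    refine tsum_congr fun i => ?_
    rw [hR]
    by_cases hi : i ∈ s <;> simp [hi]
  have h₀ : Filter.Tendsto (fun s => hsNorm (T - R s) ^ 2) Filter.atTop (nhds 0) := by
    simp_rw [hsum]
    exact ENNReal.tendsto_tsum_compl_atTop_zero hT.ne
  have h₁ : Filter.Tendsto R Filter.atTop (nhds T) := by
    rw [tendsto_iff_edist_tendsto_0]
    have h₂ : Filter.Tendsto (fun s => hsNorm (T - R s)) Filter.atTop (nhds 0) := by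
      have := h₀.ennrpow_const (1 / 2 : ℝ)
      have e : ∀ s, (hsNorm (T - R s) ^ 2) ^ (1 / 2 : ℝ) = hsNorm (T - R s) := fun s => by
        rw [← ENNReal.rpow_natCast, ← ENNReal.rpow_mul]
        norm_num
      simpa only [e, ENNReal.zero_rpow_of_pos (show (0 : ℝ) < 1 / 2 by norm_num)] using this
    refine tendsto_of_tendsto_of_tendsto_of_le_of_le tendsto_const_nhds h₂ (fun s => zero_le)
      fun s => ?_
    rw [edist_comm, edist_eq_enorm_sub]
    exact enorm_le_hsNorm _
  refine isCompactOperator_of_tendsto h₁ (Filter.Eventually.of_forall fun s => ?_)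
  change R s ∈ compactOperator (RingHom.id ℂ) E F
  refine Submodule.sum_mem _ fun i _ => ?_
  change IsCompactOperator fun x => (innerSL ℂ (b i) x) • T (b i)
  have hc : IsCompactOperator (innerSL ℂ (b i)) :=
    isCompactOperator_of_locallyCompactSpace_dom _
  exact hc.clm_comp ((ContinuousLinearMap.id ℂ ℂ).smulRight (T (b i)))

end HilbertSchmidt

/-! ### The real structure and polarizations. -/

section Conjugation

open Complexification

variable {H : Type*} [NormedAddCommGroup H] [InnerProductSpace ℝ H]

@[simp] theorem conj_conj (v : Complexification H) : conj (conj v) = v := by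
  ext <;> simp [conj]

theorem inner_conj_left (v w : Complexification H) :
    inner ℂ (conj v) w = inner ℂ (conj w) v := by
  apply Complex.ext <;> simp [inner_def, conj, real_inner_comm]
  ring

theorem inner_conj_right (v w : Complexification H) :
    inner ℂ v (conj w) = inner ℂ w (conj v) := by
  rw [← inner_conj_symm, inner_conj_left, inner_conj_symm]

@[simp] theorem mem_conjImage {W : Submodule ℂ (Complexification H)} {v : Complexification H} :
    v ∈ conjImage W ↔ conj v ∈ W := by
  constructor
  · rintro ⟨x, hx, rfl⟩
    simpa using hx
  · exact fun h => ⟨conj v, h, conj_conj v⟩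

variable [CompleteSpace H]

theorem mem_PolG_iff {W : Submodule ℂ (Complexification H)} :
    W ∈ PolG H ↔ IsClosed (W : Set (Complexification H)) ∧ conjImage W = Wᗮ := by
  constructor
  · rintro ⟨hc, ho, hW⟩
    refine ⟨hc, le_antisymm ho.ge fun v hv => ?_⟩
    -- As `y` already lies in `W^⊥`, the component `x` lies in `W ∩ W^⊥ = 0`.
    obtain ⟨x, hx, y, hy, rfl⟩ : ∃ x ∈ W, ∃ y ∈ conjImage W, x + y = v :=
      Submodule.mem_sup.1 (hW.sup_eq_top ▸ Submodule.mem_top)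
    have : x ∈ Wᗮ := by simpa using Submodule.sub_mem _ hv (ho.ge hy)
    have hx0 : x = 0 := by
      simpa using (Submodule.inf_orthogonal_eq_bot W).le ⟨hx, this⟩
    simpa [hx0] using hy
  · rintro ⟨hc, hW⟩
    have : CompleteSpace W := hc.completeSpace_coe
    rw [PolG, Set.mem_ofPred_eq, hW]
    exact ⟨hc, Submodule.isOrtho_orthogonal_right W, W.isCompl_orthogonal⟩

theorem mem_orthogonal_iff_of_mem_PolG {W : Submodule ℂ (Complexification H)} (hW : W ∈ PolG H)
    {v : Complexification H} : v ∈ Wᗮ ↔ conj v ∈ W := by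
  rw [← (mem_PolG_iff.1 hW).2, mem_conjImage]

theorem mem_PolG₂_iff {J : H →L[ℝ] H} {ι : Type*} (e : HilbertBasis ι ℂ (Lplus J))
    {W : Submodule ℂ (Complexification H)} :
    W ∈ PolG₂ J ↔ W ∈ PolG H ∧
      ∑' k, ‖Wᗮ.starProjection (e k : Complexification H)‖ₑ ^ 2 < ∞ := by
  refine and_congr_right fun hW => ?_
  rw [(mem_PolG_iff.1 hW).2]
  constructor
  · rintro ⟨_, h⟩
    rw [isHilbertSchmidt_iff e] at h
    exact h
  · intro h
    refine ⟨inferInstance, ?_⟩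
    rw [isHilbertSchmidt_iff e]
    exact h

end Conjugation

/-! ### Subspaces as graphs over `U`. -/

section Graph

open Complexification

variable {H : Type*} [NormedAddCommGroup H] [InnerProductSpace ℝ H]

theorem mem_graph {U : Submodule ℂ (Complexification H)} {Z : U →L[ℂ] Uᗮ}
    {v : Complexification H} : v ∈ graph Z ↔ ∃ x : U, (x : Complexification H) + Z x = v :=
  Iff.rfl

theorem add_mem_graph {U : Submodule ℂ (Complexification H)} (Z : U →L[ℂ] Uᗮ) (x : U) :
    (x : Complexification H) + Z x ∈ graph Z :=
  ⟨x, rfl⟩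

/-- Components along `U` and `Uᗮ` are unique. -/
theorem eq_and_eq_of_add_eq_add {U : Submodule ℂ (Complexification H)} {x x' : U} {y y' : Uᗮ}
    (h : (x : Complexification H) + y = x' + y') : x = x' ∧ y = y' := by
  have h₁ : (x : Complexification H) - x' = y' - y := by
    rw [sub_eq_sub_iff_add_eq_add, h, add_comm]
  have h₂ : (x : Complexification H) - x' = 0 := by
    refine (Submodule.inf_orthogonal_eq_bot U).le ⟨U.sub_mem x.2 x'.2, ?_⟩
    rw [h₁]
    exact Uᗮ.sub_mem y'.2 y.2
  refine ⟨Subtype.ext (sub_eq_zero.1 h₂), Subtype.ext ?_⟩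
  rw [h₂, eq_comm, sub_eq_zero] at h₁
  exact h₁.symm

theorem graph_injective {U : Submodule ℂ (Complexification H)} :
    Function.Injective (graph : (U →L[ℂ] Uᗮ) → Submodule ℂ (Complexification H)) := by
  intro Z Z' h
  ext1 x
  obtain ⟨y, hy⟩ := mem_graph.1 (h ▸ add_mem_graph Z x)
  obtain ⟨rfl, h₂⟩ := eq_and_eq_of_add_eq_add hy
  exact h₂.symm

theorem norm_le_norm_add {U : Submodule ℂ (Complexification H)} (x : U) (y : Uᗮ) :
    ‖x‖ ≤ ‖(x : Complexification H) + y‖ ∧ ‖y‖ ≤ ‖(x : Complexification H) + y‖ := by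
  have h : ‖(x : Complexification H) + y‖ * ‖(x : Complexification H) + y‖ =
      ‖x‖ * ‖x‖ + ‖y‖ * ‖y‖ :=
    norm_add_sq_eq_norm_sq_add_norm_sq_of_inner_eq_zero _ _
      (Submodule.inner_right_of_mem_orthogonal x.2 y.2)
  constructor <;> refine abs_le_of_sq_le_sq' ?_ (norm_nonneg _) |>.2 <;>
    nlinarith [mul_self_nonneg ‖x‖, mul_self_nonneg ‖y‖]

/-- Fredholm alternative for the compact operator `C = P_U P_{W^⊥}` on `U`, with `1 - C = P_U P_W`.
Surjectivity of `1 - C` gives that of `P_U : W → U`, whose kernel is `W ∩ U^⊥`. -/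
theorem exists_eq_graph {U W : Submodule ℂ (Complexification H)} [CompleteSpace U]
    [CompleteSpace W] (hc : IsCompactOperator (Wᗮ.orthogonalProjectionOnto ∘L U.subtypeL))
    (h₁ : W ⊓ Uᗮ = ⊥) (h₂ : U ⊓ Wᗮ = ⊥) : ∃ Z : U →L[ℂ] Uᗮ, W = graph Z := by
  let C : U →L[ℂ] U := (U.orthogonalProjectionOnto ∘L Wᗮ.subtypeL) ∘L
    (Wᗮ.orthogonalProjectionOnto ∘L U.subtypeL)
  have hC : IsCompactOperator C := hc.clm_comp (U.orthogonalProjectionOnto ∘L Wᗮ.subtypeL)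
  have hCx : ∀ x : U, C x = U.orthogonalProjectionOnto (Wᗮ.starProjection x) := fun _ => rfl
  -- A fixed vector of `C` loses no norm under `P_{W^⊥}`, so by Pythagoras it lies in `U ∩ W^⊥`.
  have hev : ¬ Module.End.HasEigenvalue (C : Module.End ℂ U) 1 := by
    intro h
    obtain ⟨x, hx, hx0⟩ := h.exists_hasEigenvector
    rw [Module.End.mem_eigenspace_iff, one_smul] at hx
    have hx' : U.orthogonalProjectionOnto (Wᗮ.starProjection (x : Complexification H)) = x := hx
    refine hx0 (Subtype.ext ((h₂.le ⟨x.2, ?_⟩ : (x : Complexification H) ∈ (⊥ : Submodule ℂ _))))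
    rw [SetLike.mem_coe, ← Submodule.starProjection_eq_self_iff, ← sub_eq_zero, ← norm_eq_zero]
    have hle : ‖x‖ ≤ ‖Wᗮ.starProjection (x : Complexification H)‖ := by
      conv_lhs => rw [← hx']
      exact U.norm_orthogonalProjectionOnto_apply_le _
    have hp := Submodule.norm_sq_eq_add_norm_sq_starProjection (x : Complexification H) Wᗮ
    rw [Submodule.starProjection_orthogonal_val (K := Wᗮ)] at hp
    have hx₂ : ‖(x : Complexification H)‖ = ‖x‖ := rfl
    rw [norm_sub_rev]
    have := norm_nonneg x
    refine pow_eq_zero_iff two_ne_zero |>.1 (le_antisymm ?_ (sq_nonneg _))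
    rw [hx₂] at hp
    nlinarith
  have hres := (hC.hasEigenvalue_or_mem_resolventSet one_ne_zero).resolve_left hev
  rw [spectrum.mem_resolventSet_iff, ContinuousLinearMap.isUnit_iff_bijective] at hres
  let T : W →L[ℂ] U := U.orthogonalProjectionOnto ∘L W.subtypeL
  have hker : T.ker = ⊥ := by
    rw [eq_bot_iff]
    intro w hw
    have : (w : Complexification H) ∈ Uᗮ := U.orthogonalProjectionOnto_eq_zero_iff.1 hw
    exact Subtype.ext (h₁.le ⟨w.2, this⟩ : (w : Complexification H) ∈ (⊥ : Submodule ℂ _))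
  have hrange : T.range = ⊤ := by
    rw [eq_top_iff]
    intro x _
    obtain ⟨y, hy⟩ := hres.2 x
    -- With `(1 - C) y = x`, the vector `P_W y` is a preimage of `x`.
    refine ⟨W.orthogonalProjectionOnto y, ?_⟩
    have h₃ : (W.orthogonalProjectionOnto (y : Complexification H) : Complexification H) =
        y - Wᗮ.starProjection (y : Complexification H) := by
      rw [Submodule.starProjection_orthogonal_val]
      simp
    change U.orthogonalProjectionOnto (W.orthogonalProjectionOnto (y : Complexification H) : Complexification H) = x
    rw [h₃, map_sub, Submodule.orthogonalProjectionOnto_mem_subspace_eq_self, ← hCx, ← hy]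
    simp
  let T' := ContinuousLinearEquiv.ofBijective T hker hrange
  refine ⟨Uᗮ.orthogonalProjectionOnto ∘L W.subtypeL ∘L (T'.symm : U →L[ℂ] W), ?_⟩
  have key : ∀ w : W, ((T' w : U) : Complexification H) +
      (Uᗮ.orthogonalProjectionOnto (w : Complexification H) : Complexification H) = w :=
    fun w => Submodule.starProjection_add_starProjection_orthogonal (K := U) (w : Complexification H)
  ext v
  rw [mem_graph]
  constructor
  · intro hv
    refine ⟨T' ⟨v, hv⟩, ?_⟩
    simpa using key ⟨v, hv⟩
  · rintro ⟨x, rfl⟩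
    have := key (T'.symm x)
    rw [ContinuousLinearEquiv.apply_symm_apply] at this
    change (x : Complexification H) + (Uᗮ.orthogonalProjectionOnto (T'.symm x : Complexification H) : Complexification H) ∈ W
    rw [this]
    exact (T'.symm x).2

variable [CompleteSpace H]

/-- Vectors of `U ∩ W^⊥` are fixed by the compact operator `P_U P_{W^⊥}`, whose eigenspace for `1`
is finite-dimensional. -/
theorem finiteDimensional_of_isCompactOperator {U W : Submodule ℂ (Complexification H)}
    [CompleteSpace U] (hc : IsCompactOperator (Wᗮ.orthogonalProjectionOnto ∘L U.subtypeL)) :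
    FiniteDimensional ℂ (Wᗮ.comap U.subtype) := by
  let C : U →L[ℂ] U := (U.orthogonalProjectionOnto ∘L Wᗮ.subtypeL) ∘L
    (Wᗮ.orthogonalProjectionOnto ∘L U.subtypeL)
  have hC : IsCompactOperator C := hc.clm_comp (U.orthogonalProjectionOnto ∘L Wᗮ.subtypeL)
  have := C.finite_dimensional_eigenspace hC 1 one_ne_zero
  refine Submodule.finiteDimensional_of_le (S₂ := Module.End.eigenspace C.toLinearMap 1) ?_
  intro x hx
  rw [Module.End.mem_eigenspace_iff, one_smul]
  change U.orthogonalProjectionOnto (Wᗮ.starProjection (x : Complexification H)) = x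
  have hx' : (x : Complexification H) ∈ Wᗮ := hx
  rw [Submodule.starProjection_eq_self_iff.2 hx',
    Submodule.orthogonalProjectionOnto_mem_subspace_eq_self]

theorem norm_starProjection_orthogonal_graph_le {U : Submodule ℂ (Complexification H)}
    (Z : U →L[ℂ] Uᗮ) (x : U) :
    ‖(graph Z)ᗮ.starProjection (x : Complexification H)‖ ≤ ‖Z x‖ := by
  have h : (graph Z)ᗮ.starProjection ((x : Complexification H) + Z x) = 0 :=
    Submodule.starProjection_orthogonal_apply_eq_zero (add_mem_graph Z x)
  rw [map_add, add_eq_zero_iff_eq_neg] at h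
  rw [h, norm_neg]
  exact Submodule.norm_starProjection_apply_le _ _

/-- If `P_W x = y + Z y` with `W` the graph, then `P_{W^⊥} x` has components `x - y` and `-Z y`,
each of norm at most `‖P_{W^⊥} x‖`. Together with the preceding bound this makes `Z` and `P_{W^⊥}`
on `U` Hilbert–Schmidt simultaneously. -/
theorem norm_le_mul_norm_starProjection {U : Submodule ℂ (Complexification H)}
    (Z : U →L[ℂ] Uᗮ) (hZ : IsClosed (graph Z : Set (Complexification H))) (x : U) :
    ‖Z x‖ ≤ (1 + ‖Z‖) * ‖(graph Z)ᗮ.starProjection (x : Complexification H)‖ := by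
  have : CompleteSpace (graph Z) := hZ.completeSpace_coe
  obtain ⟨y, hy⟩ := mem_graph.1 ((graph Z).starProjection_apply_mem (x : Complexification H))
  have hd : (graph Z)ᗮ.starProjection (x : Complexification H) =
      ((x - y : U) : Complexification H) + ((-Z y : Uᗮ) : Complexification H) := by
    rw [Submodule.starProjection_orthogonal_val, ← hy]
    push_cast
    abel
  rw [hd]
  obtain ⟨h₁, h₂⟩ := norm_le_norm_add (x - y) (-Z y)
  rw [norm_neg] at h₂
  set d := ‖((x - y : U) : Complexification H) + ((-Z y : Uᗮ) : Complexification H)‖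
  calc ‖Z x‖ = ‖Z (x - y) + Z y‖ := by rw [map_sub, sub_add_cancel]
    _ ≤ ‖Z (x - y)‖ + ‖Z y‖ := norm_add_le _ _
    _ ≤ ‖Z‖ * ‖x - y‖ + ‖Z y‖ := by gcongr; exact Z.le_opNorm _
    _ ≤ ‖Z‖ * d + d := by gcongr
    _ = (1 + ‖Z‖) * d := by ring

theorem conj_coe_mem {U : Submodule ℂ (Complexification H)} (hU : U ∈ PolG H) :
    (∀ x : U, conj (x : Complexification H) ∈ Uᗮ) ∧
      ∀ x : Uᗮ, conj (x : Complexification H) ∈ U :=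
  ⟨fun x => (mem_orthogonal_iff_of_mem_PolG hU).2 (by simp),
    fun x => (mem_orthogonal_iff_of_mem_PolG hU).1 x.2⟩

/-- The orthogonal complement of the graph is `{u - Z^* u | u ∈ U^⊥}`, while its conjugate is `{u +
α Z α u | u ∈ U^⊥}`; the symmetry of `Z` identifies the two. -/
theorem graph_mem_PolG {U : Submodule ℂ (Complexification H)} [CompleteSpace U] (hU : U ∈ PolG H)
    {Z : U →L[ℂ] Uᗮ} (hZ : Z ∈ B₂α U) : graph Z ∈ PolG H := by
  obtain ⟨-, hα, hsym⟩ := hZ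
  have h : conjImage (graph Z) = (graph Z)ᗮ := by
    ext v
    rw [mem_conjImage]
    constructor
    · rw [mem_graph, Submodule.mem_orthogonal]
      rintro ⟨y, hy⟩ w ⟨x, rfl⟩
      have hv : v = conj (y : Complexification H) + conj (Z y : Complexification H) := by
        rw [← map_add, hy, conj_conj]
      have hs := hsym ⟨conj (y : Complexification H), (conj_coe_mem hU).1 y⟩
      simp only [conj_conj, Subtype.coe_eta] at hs
      change inner ℂ ((x : Complexification H) + Z x) v = 0
      have h₁ := Submodule.inner_right_of_mem_orthogonal x.2 ((conj_coe_mem hU).1 y)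
      have h₂ := Submodule.inner_left_of_mem_orthogonal ((conj_coe_mem hU).2 (Z y)) (Z x).2
      have h₃ := ContinuousLinearMap.adjoint_inner_right Z x
        ⟨conj (y : Complexification H), (conj_coe_mem hU).1 y⟩
      simp only [Submodule.coe_inner] at h₃
      rw [hv, inner_add_left, inner_add_right, inner_add_right, h₁, h₂, hs, inner_neg_right, h₃]
      ring
    · intro hv
      set a := U.orthogonalProjectionOnto v with ha
      set u := Uᗮ.orthogonalProjectionOnto v with hu
      have hv' : (a : Complexification H) + u = v :=
        Submodule.starProjection_add_starProjection_orthogonal (K := U) v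
      have hau : a = -ContinuousLinearMap.adjoint Z u := by
        rw [← add_eq_zero_iff_eq_neg]
        refine ext_inner_left ℂ fun x => ?_
        rw [inner_zero_right, inner_add_right, ContinuousLinearMap.adjoint_inner_right]
        have h₀ := Submodule.inner_right_of_mem_orthogonal (add_mem_graph Z x) hv
        have h₁ := Submodule.inner_right_of_mem_orthogonal x.2 u.2
        have h₂ := Submodule.inner_left_of_mem_orthogonal a.2 (Z x).2
        rw [← hv', inner_add_left, inner_add_right, inner_add_right, h₁, h₂] at h₀
        simpa using h₀
      have hs := hsym u
      rw [mem_graph]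
      refine ⟨⟨conj (u : Complexification H), hα u⟩, ?_⟩
      rw [← hv', hau, Submodule.coe_neg, ← hs, map_add, conj_conj, add_comm]
  refine mem_PolG_iff.2 ⟨?_, h⟩
  -- Closedness comes for free: the graph is the preimage under `α` of an orthogonal complement.
  have : (graph Z : Set (Complexification H)) = conj ⁻¹' ((graph Z)ᗮ : Set (Complexification H)) := by
    ext v
    rw [Set.mem_preimage, SetLike.mem_coe, SetLike.mem_coe, ← h, mem_conjImage, conj_conj]
  rw [this]
  exact (Submodule.isClosed_orthogonal _).preimage conj.continuous

theorem mem_B₂α_of_graph_mem_PolG {U : Submodule ℂ (Complexification H)} [CompleteSpace U]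
    (hU : U ∈ PolG H) {Z : U →L[ℂ] Uᗮ} (hZ : graph Z ∈ PolG H) (hs : IsHilbertSchmidt Z) :
    Z ∈ B₂α U := by
  refine ⟨hs, (conj_coe_mem hU).2, fun u => ?_⟩
  set y : U := ⟨conj (u : Complexification H), (conj_coe_mem hU).2 u⟩ with hy
  set b : U := ⟨conj (Z y : Complexification H), (conj_coe_mem hU).2 (Z y)⟩ with hb
  suffices b = -ContinuousLinearMap.adjoint Z u from congrArg Subtype.val this
  rw [← add_eq_zero_iff_eq_neg]
  refine ext_inner_left ℂ fun x => ?_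
  rw [inner_zero_right, inner_add_right, ContinuousLinearMap.adjoint_inner_right]
  -- The vector `u + α Z α u` is the conjugate of a point of the graph, hence orthogonal to the
  -- graph.
  have h₀ : inner ℂ ((x : Complexification H) + Z x) ((u : Complexification H) + b) = 0 := by
    refine Submodule.inner_right_of_mem_orthogonal (add_mem_graph Z x) ?_
    rw [mem_orthogonal_iff_of_mem_PolG hZ, map_add, hb, conj_conj]
    exact add_mem_graph Z y
  have h₁ := Submodule.inner_right_of_mem_orthogonal x.2 u.2
  have h₂ := Submodule.inner_left_of_mem_orthogonal b.2 (Z x).2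
  rw [inner_add_left, inner_add_right, inner_add_right, h₁, h₂] at h₀
  simpa using h₀

end Graph

/-! ### The subspaces `W_S`, their bases and the charts. -/

section Charts

open Complexification

variable {H : Type*} [NormedAddCommGroup H] [InnerProductSpace ℝ H]

theorem mem_Lplus {J : H →L[ℝ] H} {v : Complexification H} :
    v ∈ Lplus J ↔ extend J v = Complex.I • v := by
  rw [Lplus, LinearMap.mem_ker, ContinuousLinearMap.coe_coe, sub_apply, sub_eq_zero]
  rfl

theorem extend_conj (J : H →L[ℝ] H) (v : Complexification H) :
    extend J (conj v) = conj (extend J v) := by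
  ext <;> simp [extend, conj]

theorem inner_extend_extend {J : H →L[ℝ] H} {ω : H →L[ℝ] H →L[ℝ] ℝ} (h : IsCompatibleTriple J ω)
    (v w : Complexification H) : inner ℂ (extend J v) (extend J w) = inner ℂ v w := by
  have key : ∀ x y : H, ⟪J x, J y⟫_ℝ = ⟪x, y⟫_ℝ := fun x y => by
    rw [h.compat, h.sq_eq, map_neg, h.skew, neg_neg, ← h.compat, real_inner_comm]
  simp [inner_def, extend, key]

/-- The extension of `J` preserves the inner product and acts by `i` on `x` and by `-i` on `α y`, so
the inner product equals its own negative. -/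
theorem inner_conj_eq_zero {J : H →L[ℝ] H} {ω : H →L[ℝ] H →L[ℝ] ℝ} (h : IsCompatibleTriple J ω)
    {x y : Complexification H} (hx : x ∈ Lplus J) (hy : y ∈ Lplus J) :
    inner ℂ x (conj y) = 0 := by
  have h₁ := inner_extend_extend h x (conj y)
  rw [extend_conj, mem_Lplus.1 hx, mem_Lplus.1 hy, map_smulₛₗ, inner_smul_left, inner_smul_right,
    Complex.conj_I, ← mul_assoc, neg_mul_neg, Complex.I_mul_I, neg_one_mul] at h₁
  exact self_eq_neg.1 h₁.symm

/-- `L⁺` and its conjugate span the complexification. -/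
theorem eq_zero_of_inner_Lplus {J : H →L[ℝ] H} (hJ : ∀ v, J (J v) = -v) {u : Complexification H}
    (h₁ : ∀ x ∈ Lplus J, inner ℂ x u = 0) (h₂ : ∀ x ∈ Lplus J, inner ℂ (conj x) u = 0) : u = 0 := by
  have hJJ : extend J (extend J u) = -u := by
    have e : extend J (extend J u) + u = 0 := by ext <;> simp [extend, hJ]
    exact eq_neg_of_add_eq_zero_left e
  have hI : Complex.I • Complex.I • extend J u = -extend J u := by
    rw [smul_smul, Complex.I_mul_I, neg_one_smul]
  have hI' : Complex.I • Complex.I • u = -u := by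
    rw [smul_smul, Complex.I_mul_I, neg_one_smul]
  -- Split `2u = (u - iJu) + (u + iJu)`, with summands in `L⁺` and `α(L⁺)`; `u` is orthogonal to
  -- both.
  have a₁ := h₁ (u - Complex.I • extend J u) (by
    rw [mem_Lplus, map_sub, map_smul, hJJ, smul_sub, hI, smul_neg]
    abel)
  have a₂ := h₂ (conj (u + Complex.I • extend J u)) (by
    rw [mem_Lplus, extend_conj, map_add, map_smul, hJJ]
    have : extend J u + Complex.I • -u = -(Complex.I • (u + Complex.I • extend J u)) := by
      rw [smul_add, hI, smul_neg]
      abel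
    rw [this, map_neg, map_smulₛₗ, Complex.conj_I, neg_smul, neg_neg])
  rw [conj_conj] at a₂
  have : inner ℂ u u + inner ℂ u u = 0 := by
    rw [← inner_add_left, show u + u = (u - Complex.I • extend J u) + (u + Complex.I • extend J u)
      by abel, inner_add_left, a₁, a₂, add_zero]
  exact inner_self_eq_zero.1 (self_eq_neg.1 (eq_neg_of_add_eq_zero_left this))

variable {J : H →L[ℝ] H} {I : Set ℕ+}

open Classical in
/-- The orthonormal basis of `W_S`: the `e k` with `k ∉ S` and the `α (e l)` with `l ∈ S`. -/
noncomputable def basisVec (e : HilbertBasis I ℂ (Lplus J)) (S : Finset I) (k : I) : Complexification H :=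
  if k ∈ S then conj (e k : Complexification H) else e k

theorem basisVec_of_mem (e : HilbertBasis I ℂ (Lplus J)) {S : Finset I} {k : I} (hk : k ∈ S) :
    basisVec e S k = conj (e k : Complexification H) :=
  if_pos hk

theorem basisVec_of_notMem (e : HilbertBasis I ℂ (Lplus J)) {S : Finset I} {k : I} (hk : k ∉ S) :
    basisVec e S k = e k :=
  if_neg hk

theorem WS_eq (e : HilbertBasis I ℂ (Lplus J)) (S : Finset I) :
    WS e S = (Submodule.span ℂ (Set.range (basisVec e S))).topologicalClosure := by
  rw [WS]
  congr 2
  ext v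
  constructor
  · rintro (⟨k, hk, rfl⟩ | ⟨k, hk, rfl⟩)
    · exact ⟨k, basisVec_of_notMem e hk⟩
    · exact ⟨k, basisVec_of_mem e hk⟩
  · rintro ⟨k, rfl⟩
    by_cases hk : k ∈ S
    · exact Or.inr ⟨k, hk, basisVec_of_mem e hk⟩
    · exact Or.inl ⟨k, hk, basisVec_of_notMem e hk⟩

theorem basisVec_mem_WS (e : HilbertBasis I ℂ (Lplus J)) (S : Finset I) (k : I) :
    basisVec e S k ∈ WS e S := by
  rw [WS_eq]
  exact Submodule.le_topologicalClosure _ (Submodule.subset_span ⟨k, rfl⟩)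

theorem WS_le (e : HilbertBasis I ℂ (Lplus J)) (S : Finset I)
    {K : Submodule ℂ (Complexification H)} (hK : IsClosed (K : Set (Complexification H)))
    (h : ∀ k, basisVec e S k ∈ K) : WS e S ≤ K := by
  rw [WS_eq]
  refine Submodule.topologicalClosure_minimal _ (Submodule.span_le.2 ?_) hK
  rintro _ ⟨k, rfl⟩
  exact h k

theorem mem_WS_orthogonal (e : HilbertBasis I ℂ (Lplus J)) (S : Finset I)
    {v : Complexification H} : v ∈ (WS e S)ᗮ ↔ ∀ k, inner ℂ (basisVec e S k) v = 0 := by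
  constructor
  · exact fun h k => Submodule.inner_right_of_mem_orthogonal (basisVec_mem_WS e S k) h
  · intro h
    have hle : WS e S ≤ (ℂ ∙ v)ᗮ := WS_le e S (Submodule.isClosed_orthogonal _) fun k =>
      Submodule.mem_orthogonal_singleton_iff_inner_left.2 (h k)
    exact fun u hu => Submodule.mem_orthogonal_singleton_iff_inner_left.1 (hle hu)

variable {ω : H →L[ℝ] H →L[ℝ] ℝ}

theorem orthonormal_basisVec (hJω : IsCompatibleTriple J ω) (e : HilbertBasis I ℂ (Lplus J))
    (S : Finset I) : Orthonormal ℂ (basisVec e S) := by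
  constructor
  · intro k
    have hk : ‖(e k : Complexification H)‖ = 1 := e.orthonormal.1 k
    by_cases h : k ∈ S
    · rw [basisVec_of_mem e h, LinearIsometryEquiv.norm_map, hk]
    · rw [basisVec_of_notMem e h, hk]
  · intro k l hkl
    have ho : ∀ {i j}, i ≠ j → inner ℂ (e i : Complexification H) (e j : Complexification H) = 0 :=
      fun h => e.orthonormal.2 h
    by_cases hk : k ∈ S <;> by_cases hl : l ∈ S <;>
      simp only [basisVec_of_mem, basisVec_of_notMem, hk, hl, not_false_iff]
    · rw [inner_conj_left, conj_conj, ho hkl.symm]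
    · rw [← inner_conj_symm, inner_conj_eq_zero hJω (e l).2 (e k).2, map_zero]
    · exact inner_conj_eq_zero hJω (e k).2 (e l).2
    · exact ho hkl

theorem inner_basisVec_conj (hJω : IsCompatibleTriple J ω) (e : HilbertBasis I ℂ (Lplus J))
    (S : Finset I) (k l : I) : inner ℂ (basisVec e S k) (conj (basisVec e S l)) = 0 := by
  have ho : ∀ {i j}, i ≠ j → inner ℂ (e i : Complexification H) (e j : Complexification H) = 0 :=
    fun h => e.orthonormal.2 h
  by_cases hk : k ∈ S <;> by_cases hl : l ∈ S <;>
    simp only [basisVec_of_mem, basisVec_of_notMem, hk, hl, not_false_iff, conj_conj]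
  · rw [← inner_conj_symm, inner_conj_eq_zero hJω (e l).2 (e k).2, map_zero]
  · rw [inner_conj_left, conj_conj, ho]
    rintro rfl
    exact hl hk
  · refine ho ?_
    rintro rfl
    exact hk hl
  · exact inner_conj_eq_zero hJω (e k).2 (e l).2

variable [CompleteSpace H]

theorem inner_eq_zero_of_basis (e : HilbertBasis I ℂ (Lplus J)) {u : Complexification H}
    (h : ∀ k, inner ℂ (e k : Complexification H) u = 0) {x : Complexification H}
    (hx : x ∈ Lplus J) : inner ℂ x u = 0 := by
  have hp : (Lplus J).orthogonalProjectionOnto u = 0 := by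
    refine e.repr.injective (lp.ext (funext fun k => ?_))
    rw [e.repr_apply_apply, Submodule.coe_inner, map_zero]
    change inner ℂ (e k : Complexification H) ((Lplus J).starProjection u) = 0
    rw [← Submodule.inner_starProjection_left_eq_right,
      Submodule.starProjection_eq_self_iff.2 (e k).2, h]
  exact (Lplus J).orthogonalProjectionOnto_eq_zero_iff.1 hp x hx

theorem eq_zero_of_inner_basis (hJω : IsCompatibleTriple J ω) (e : HilbertBasis I ℂ (Lplus J))
    {u : Complexification H} (h₁ : ∀ k, inner ℂ (e k : Complexification H) u = 0)
    (h₂ : ∀ k, inner ℂ (conj (e k : Complexification H)) u = 0) : u = 0 := by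
  refine eq_zero_of_inner_Lplus hJω.sq_eq (fun x hx => inner_eq_zero_of_basis e h₁ hx)
    fun x hx => ?_
  have h₃ : ∀ k, inner ℂ (e k : Complexification H) (conj u) = 0 := fun k => by
    rw [inner_conj_right, ← inner_conj_symm, h₂, map_zero]
  rw [← inner_conj_symm, inner_conj_right, inner_eq_zero_of_basis e h₃ hx, map_zero]

theorem WS_mem_PolG (hJω : IsCompatibleTriple J ω) (e : HilbertBasis I ℂ (Lplus J))
    (S : Finset I) : WS e S ∈ PolG H := by
  rw [mem_PolG_iff]
  refine ⟨Submodule.isClosed_topologicalClosure _, le_antisymm ?_ ?_⟩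
  · have hle : WS e S ≤ conjImage (WS e S)ᗮ := by
      refine WS_le e S ?_ fun k => ?_
      · have : (conjImage (WS e S)ᗮ : Set (Complexification H)) =
            conj ⁻¹' ((WS e S)ᗮ : Set (Complexification H)) := by
          ext v
          exact mem_conjImage
        rw [this]
        exact (Submodule.isClosed_orthogonal _).preimage conj.continuous
      · rw [mem_conjImage, mem_WS_orthogonal]
        exact fun l => inner_basisVec_conj hJω e S l k
    intro v hv
    simpa using hle (mem_conjImage.1 hv)
  · intro v hv
    rw [mem_conjImage]
    have hv' := (mem_WS_orthogonal e S).1 hv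
    have h₁ : ∀ k, inner ℂ (basisVec e S k) ((WS e S)ᗮ.starProjection (conj v)) = 0 :=
      (mem_WS_orthogonal e S).1 (Submodule.starProjection_apply_mem _ _)
    have h₂ : ∀ k, inner ℂ (conj (basisVec e S k)) ((WS e S)ᗮ.starProjection (conj v)) = 0 := by
      intro k
      rw [Submodule.starProjection_orthogonal_val, inner_sub_right, inner_conj_left, conj_conj,
        ← inner_conj_symm, hv', map_zero, zero_sub, neg_eq_zero]
      refine Submodule.inner_left_of_mem_orthogonal (Submodule.starProjection_apply_mem _ _) ?_
      exact (mem_WS_orthogonal e S).2 fun l => inner_basisVec_conj hJω e S l k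
    -- The part of `α v` orthogonal to `W_S` is orthogonal to the basis of `W_S` and to its
    -- conjugate, which together consist of all `e k` and `α (e k)`.
    have hu : (WS e S)ᗮ.starProjection (conj v) = 0 := by
      refine eq_zero_of_inner_basis hJω e (fun k => ?_) fun k => ?_
      · by_cases hk : k ∈ S
        · simpa [basisVec_of_mem e hk] using h₂ k
        · simpa [basisVec_of_notMem e hk] using h₁ k
      · by_cases hk : k ∈ S
        · simpa [basisVec_of_mem e hk] using h₁ k
        · simpa [basisVec_of_notMem e hk] using h₂ k
    rwa [Submodule.starProjection_apply_eq_zero_iff, Submodule.orthogonal_orthogonal] at hu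

theorem exists_hilbertBasis_WS (hJω : IsCompatibleTriple J ω) (e : HilbertBasis I ℂ (Lplus J))
    (S : Finset I) : ∃ b : HilbertBasis I ℂ (WS e S),
      ∀ k, (b k : Complexification H) = basisVec e S k := by
  have ho : Orthonormal ℂ fun k => (⟨basisVec e S k, basisVec_mem_WS e S k⟩ : WS e S) := by
    have h := orthonormal_basisVec hJω e S
    exact ⟨fun k => h.1 k, fun k l hkl => h.2 hkl⟩
  refine ⟨HilbertBasis.mkOfOrthogonalEqBot ho ?_, fun k => ?_⟩
  · rw [eq_bot_iff]
    intro x hx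
    have : (x : Complexification H) ∈ (WS e S)ᗮ := (mem_WS_orthogonal e S).2 fun k =>
      hx _ (Submodule.subset_span (Set.mem_range_self k))
    have h₀ : (x : Complexification H) ∈ (⊥ : Submodule ℂ (Complexification H)) :=
      (WS e S).inf_orthogonal_eq_bot ▸ Submodule.mem_inf.2 ⟨x.2, this⟩
    exact Subtype.ext h₀
  · rw [HilbertBasis.coe_mkOfOrthogonalEqBot]

theorem tsum_lt_top_of_eqOn_compl {ι : Type*} {f g : ι → ℝ≥0∞} (S : Finset ι)
    (hfg : ∀ i ∉ S, f i = g i) (hf : ∀ i, f i < ∞) (hg : ∑' i, g i < ∞) : ∑' i, f i < ∞ := by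
  classical
  have hle : ∀ i, f i ≤ g i + if i ∈ S then f i else 0 := by
    intro i
    by_cases hi : i ∈ S
    · simp [hi]
    · simp [hi, hfg i hi]
  refine (ENNReal.tsum_le_tsum hle).trans_lt ?_
  rw [ENNReal.tsum_add, tsum_eq_sum (s := S) fun i hi => if_neg hi]
  refine ENNReal.add_lt_top.2 ⟨hg, ENNReal.sum_lt_top.2 fun i hi => ?_⟩
  rw [if_pos hi]
  exact hf i

theorem mem_PolG₂_iff_basisVec (e : HilbertBasis I ℂ (Lplus J))
    (S : Finset I) {W : Submodule ℂ (Complexification H)} :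
    W ∈ PolG₂ J ↔ W ∈ PolG H ∧ ∑' k, ‖Wᗮ.starProjection (basisVec e S k)‖ₑ ^ 2 < ∞ := by
  rw [mem_PolG₂_iff e]
  have ht : ∀ v : Complexification H, ‖Wᗮ.starProjection v‖ₑ ^ 2 < ∞ :=
    fun v => ENNReal.pow_lt_top enorm_lt_top
  refine and_congr_right fun _ => ⟨tsum_lt_top_of_eqOn_compl S (fun k hk => ?_) fun k => ht _,
    tsum_lt_top_of_eqOn_compl S (fun k hk => ?_) fun k => ht _⟩ <;>
  rw [basisVec_of_notMem e hk]

theorem graph_mem_PolG₂ (hJω : IsCompatibleTriple J ω) (e : HilbertBasis I ℂ (Lplus J))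
    (S : Finset I) {Z : WS e S →L[ℂ] (WS e S)ᗮ} (hZ : Z ∈ B₂α (WS e S)) : graph Z ∈ PolG₂ J := by
  obtain ⟨b, hb⟩ := exists_hilbertBasis_WS hJω e S
  refine (mem_PolG₂_iff_basisVec e S).2 ⟨graph_mem_PolG (WS_mem_PolG hJω e S) hZ, ?_⟩
  refine (ENNReal.tsum_le_tsum fun k => ?_).trans_lt ((isHilbertSchmidt_iff b Z).1 hZ.1)
  rw [← hb]
  gcongr
  exact enorm_le_iff_norm_le.2 (norm_starProjection_orthogonal_graph_le Z (b k))

theorem isHilbertSchmidt_projection (hJω : IsCompatibleTriple J ω)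
    (e : HilbertBasis I ℂ (Lplus J)) (S : Finset I) {W : Submodule ℂ (Complexification H)}
    (hW : W ∈ PolG₂ J) :
    IsHilbertSchmidt (Wᗮ.orthogonalProjectionOnto ∘L (WS e S).subtypeL) := by
  obtain ⟨b, hb⟩ := exists_hilbertBasis_WS hJω e S
  rw [isHilbertSchmidt_iff b]
  have := ((mem_PolG₂_iff_basisVec e S).1 hW).2
  simp_rw [← hb] at this
  exact this

theorem exists_mem_B₂α_eq_graph (hJω : IsCompatibleTriple J ω) (e : HilbertBasis I ℂ (Lplus J))
    (S : Finset I) {W : Submodule ℂ (Complexification H)} (hW : W ∈ PolG₂ J)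
    (h : W ⊓ (WS e S)ᗮ = ⊥) : ∃ Z ∈ B₂α (WS e S), W = graph Z := by
  have hU := WS_mem_PolG hJω e S
  have : CompleteSpace W := hW.1.1.completeSpace_coe
  have h₂ : WS e S ⊓ Wᗮ = ⊥ := by
    rw [eq_bot_iff]
    rintro x ⟨hx₁, hx₂⟩
    have hx : conj x ∈ W ⊓ (WS e S)ᗮ :=
      ⟨(mem_orthogonal_iff_of_mem_PolG hW.1).1 hx₂,
        (mem_orthogonal_iff_of_mem_PolG hU).2 (by simpa using hx₁)⟩
    rw [h, Submodule.mem_bot] at hx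
    rw [Submodule.mem_bot]
    exact conj.map_eq_zero_iff.1 hx
  obtain ⟨Z, rfl⟩ := exists_eq_graph
    (isHilbertSchmidt_projection hJω e S hW).isCompactOperator h h₂
  refine ⟨Z, mem_B₂α_of_graph_mem_PolG hU hW.1 ?_, rfl⟩
  obtain ⟨b, hb⟩ := exists_hilbertBasis_WS hJω e S
  rw [isHilbertSchmidt_iff b]
  have hsum := ((mem_PolG₂_iff_basisVec e S).1 hW).2
  simp_rw [← hb] at hsum
  have hle : ∀ k, ‖Z (b k)‖ₑ ^ 2 ≤ ENNReal.ofReal (1 + ‖Z‖) ^ 2 *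
      ‖(graph Z)ᗮ.starProjection (b k : Complexification H)‖ₑ ^ 2 := by
    intro k
    rw [← mul_pow]
    gcongr
    rw [← ofReal_norm, ← ofReal_norm, ← ENNReal.ofReal_mul (by positivity)]
    exact ENNReal.ofReal_le_ofReal (norm_le_mul_norm_starProjection Z hW.1.1 (b k))
  refine (ENNReal.tsum_le_tsum hle).trans_lt ?_
  rw [ENNReal.tsum_mul_left]
  exact ENNReal.mul_lt_top (ENNReal.pow_lt_top ENNReal.ofReal_lt_top) hsum

/-! ### Choice of the index set `S`, and stability of transversality. -/

theorem finiteDimensional_Lplus_inf_orthogonal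
    (e : HilbertBasis I ℂ (Lplus J)) {W : Submodule ℂ (Complexification H)} (hW : W ∈ PolG₂ J) :
    FiniteDimensional ℂ (Wᗮ.comap (Lplus J).subtype) := by
  refine finiteDimensional_of_isCompactOperator (IsHilbertSchmidt.isCompactOperator ?_)
  rw [isHilbertSchmidt_iff e]
  exact ((mem_PolG₂_iff e).1 hW).2

theorem exists_inf_WS_orthogonal_eq_bot (hJω : IsCompatibleTriple J ω)
    (e : HilbertBasis I ℂ (Lplus J)) {W : Submodule ℂ (Complexification H)} (hW : W ∈ PolG₂ J) :
    ∃ S : Finset I, W ⊓ (WS e S)ᗮ = ⊥ := by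
  classical
  have := finiteDimensional_Lplus_inf_orthogonal e hW
  set M := Wᗮ.comap (Lplus J).subtype
  let φ : I → Module.Dual ℂ M := fun k => (innerSL ℂ (e k)).toLinearMap ∘ₗ M.subtype
  -- A maximal independent family among the coordinate functionals; it is finite because the dual of
  -- `M` is finite-dimensional.
  obtain ⟨κ, a, ha, hspan, hli⟩ := exists_linearIndependent' ℂ φ
  have : Finite κ := hli.finite
  have := Fintype.ofFinite κ
  refine ⟨Finset.univ.image a, ?_⟩
  set S := Finset.univ.image a with hS
  rw [eq_bot_iff]
  rintro w ⟨hw, hwS⟩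
  have hwk := (mem_WS_orthogonal e S).1 hwS
  set p := (Lplus J).orthogonalProjectionOnto w
  have hpe : ∀ x : Lplus J, inner ℂ x p = inner ℂ (x : Complexification H) w :=
    fun x => Submodule.inner_orthogonalProjectionOnto_eq_of_mem_left x w
  have hzero : ∀ k ∉ S, inner ℂ (e k : Complexification H) w = 0 := fun k hk => by
    simpa [basisVec_of_notMem e hk] using hwk k
  -- Expand `⟨m, w⟩ = 0` for `m ∈ M` in the basis `e`, where only indices in `S` contribute, and
  -- conjugate to get a relation linear in `m`.
  have hrel : ∑ i, starRingEnd ℂ (inner ℂ (e (a i) : Complexification H) w) • (φ ∘ a) i = 0 := by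
    ext m
    have hm : inner ℂ (m : Lplus J) p = 0 := by
      rw [hpe]
      exact Submodule.inner_left_of_mem_orthogonal hw m.2
    rw [← e.tsum_inner_mul_inner, tsum_eq_sum (s := S) fun k hk => by rw [hpe, hzero k hk, mul_zero],
      hS, Finset.sum_image fun i _ j _ hij => ha hij] at hm
    have := congrArg (starRingEnd ℂ) hm
    rw [map_sum, map_zero] at this
    rw [LinearMap.sum_apply, LinearMap.zero_apply, ← this]
    refine Finset.sum_congr rfl fun i _ => ?_
    rw [map_mul, hpe, inner_conj_symm (e (a i)) (m : Lplus J), mul_comm]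
    rfl
  have hcoef := Fintype.linearIndependent_iff.1 hli _ hrel
  have hwe : ∀ k, inner ℂ (e k : Complexification H) w = 0 := by
    intro k
    by_cases hk : k ∈ S
    · obtain ⟨i, -, rfl⟩ := Finset.mem_image.1 hk
      simpa only [map_eq_zero] using hcoef i
    · exact hzero k hk
  refine eq_zero_of_inner_basis hJω e hwe fun k => ?_
  -- Now `w` is orthogonal to `W_∅`, a polarization contained in `L⁺`, so `α w` lies in `W_∅`. Hence
  -- `α w ∈ M`.
  have hcw : conj w ∈ Lplus J := by
    have h₀ : w ∈ (WS e ∅)ᗮ := (mem_WS_orthogonal e ∅).2 fun k => by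
      simpa [basisVec_of_notMem e (Finset.notMem_empty k)] using hwe k
    refine WS_le e ∅ (ContinuousLinearMap.isClosed_ker _) (fun k => ?_)
      ((mem_orthogonal_iff_of_mem_PolG (WS_mem_PolG hJω e ∅)).1 h₀)
    rw [basisVec_of_notMem e (Finset.notMem_empty k)]
    exact (e k).2
  let m : M := ⟨⟨conj w, hcw⟩, (mem_orthogonal_iff_of_mem_PolG hW.1).2 (by simpa using hw)⟩
  -- The functionals indexed by `S` kill `α w`, because `w` is orthogonal to `α (e l)` for `l ∈ S`;
  -- they span all the others.
  have hφm : ∀ ψ ∈ Submodule.span ℂ (Set.range φ), ψ m = 0 := by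
    rw [← hspan]
    intro ψ hψ
    induction hψ using Submodule.span_induction with
    | mem x hx =>
      obtain ⟨i, rfl⟩ := hx
      have hi : a i ∈ S := Finset.mem_image_of_mem _ (Finset.mem_univ i)
      have h := hwk (a i)
      rw [basisVec_of_mem e hi] at h
      change inner ℂ (e (a i) : Complexification H) (conj w) = 0
      rw [inner_conj_right, ← inner_conj_symm, h, map_zero]
    | zero => rfl
    | add x y _ _ hx hy => rw [LinearMap.add_apply, hx, hy, add_zero]
    | smul c x _ hx => rw [LinearMap.smul_apply, hx, smul_zero]
  have hk : inner ℂ (e k : Complexification H) (conj w) = 0 :=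
    hφm (φ k) (Submodule.subset_span ⟨k, rfl⟩)
  rw [← inner_conj_symm, ← inner_conj_right, hk, map_zero]

/-- Write `x + Z x = y + Y y`. If `x + Z' x` is orthogonal to `W_T`, projecting to `W_T` gives `‖y‖
≤ ‖Z' - Z‖ ‖x‖`, while `‖x‖ ≤ (1 + ‖Y‖) ‖y‖`. The hypothesis makes the combined factor less than
`1`, so `x = 0`. -/
theorem graph_inf_WS_orthogonal_eq_bot (e : HilbertBasis I ℂ (Lplus J)) {S T : Finset I}
    {Z Z' : WS e S →L[ℂ] (WS e S)ᗮ} {Y : WS e T →L[ℂ] (WS e T)ᗮ} (h : graph Z = graph Y)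
    (hZ : (1 + ‖Y‖) * ‖Z' - Z‖ < 1) : graph Z' ⊓ (WS e T)ᗮ = ⊥ := by
  rw [eq_bot_iff]
  rintro _ ⟨⟨x, rfl⟩, hv⟩
  change (x : Complexification H) + Z' x ∈ (WS e T)ᗮ at hv
  change (x : Complexification H) + Z' x = 0
  obtain ⟨y, hy⟩ := mem_graph.1 (h ▸ add_mem_graph Z x)
  have hv' : (x : Complexification H) + Z' x =
      (y : Complexification H) + Y y + ((Z' - Z) x : (WS e S)ᗮ) := by
    rw [hy, sub_apply]
    push_cast
    abel
  have hPy : (WS e T).starProjection ((y : Complexification H) + Y y) = y := by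
    rw [map_add, Submodule.starProjection_eq_self_iff.2 y.2,
      (Submodule.starProjection_apply_eq_zero_iff _).2 (Y y).2, add_zero]
  have hy' : ‖y‖ ≤ ‖Z' - Z‖ * ‖x‖ := by
    have h₀ := (Submodule.starProjection_apply_eq_zero_iff _).2 hv
    rw [hv', map_add, hPy, add_eq_zero_iff_eq_neg] at h₀
    calc ‖y‖ = ‖(y : Complexification H)‖ := rfl
      _ ≤ ‖(Z' - Z) x‖ := by
        rw [h₀, norm_neg]
        exact Submodule.norm_starProjection_apply_le _ _
      _ ≤ ‖Z' - Z‖ * ‖x‖ := (Z' - Z).le_opNorm x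
  have hx : ‖x‖ ≤ (1 + ‖Y‖) * ‖y‖ := by
    calc ‖x‖ ≤ ‖(x : Complexification H) + Z x‖ := (norm_le_norm_add x (Z x)).1
      _ = ‖(y : Complexification H) + Y y‖ := by rw [hy]
      _ ≤ ‖y‖ + ‖Y y‖ := norm_add_le _ _
      _ ≤ ‖y‖ + ‖Y‖ * ‖y‖ := by gcongr; exact Y.le_opNorm y
      _ = (1 + ‖Y‖) * ‖y‖ := by ring
  have hx0 : x = 0 := by
    by_contra hne
    have hpos : 0 < ‖x‖ := norm_pos_iff.2 hne
    have : ‖x‖ ≤ ((1 + ‖Y‖) * ‖Z' - Z‖) * ‖x‖ := by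
      rw [mul_assoc]
      exact hx.trans (by gcongr)
    nlinarith
  simp [hx0]

end Charts

end RestrictedGrassmannian

open RestrictedGrassmannian in
theorem mainTheorem9 {H : Type*} [NormedAddCommGroup H] [InnerProductSpace ℝ H] [CompleteSpace H]
    (J : H →L[ℝ] H) (ω : H →L[ℝ] H →L[ℝ] ℝ) (hJω : IsCompatibleTriple J ω)
    (I : Set ℕ+) (e : HilbertBasis I ℂ (Lplus J)) :
    -- every element of the restricted Grassmannian is a graph
    (∀ W ∈ PolG₂ J, ∃ S : Finset I, ∃ Z ∈ B₂α (WS e S), W = graph Z) ∧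
    -- the sets `𝒪_S` cover the restricted Grassmannian
    (⋃ S : Finset I, OS e S) = PolG₂ J ∧
    -- taking graphs is a bijection from the model space onto `𝒪_S`
    (∀ S : Finset I, Set.BijOn graph (B₂α (WS e S)) (OS e S)) ∧
    -- in the chart on `𝒪_S`, the overlap with `𝒪_T` is open for the Hilbert–Schmidt norm
    (∀ S T : Finset I, ∀ Z ∈ B₂α (WS e S), graph Z ∈ OS e T →
      ∃ ε : ENNReal, 0 < ε ∧ ∀ Z' ∈ B₂α (WS e S), hsNorm (Z' - Z) < ε → graph Z' ∈ OS e T) := by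
  have h₁ : ∀ W ∈ PolG₂ J, ∃ S : Finset I, ∃ Z ∈ B₂α (WS e S), W = graph Z := by
    intro W hW
    obtain ⟨S, hS⟩ := exists_inf_WS_orthogonal_eq_bot hJω e hW
    exact ⟨S, exists_mem_B₂α_eq_graph hJω e S hW hS⟩
  refine ⟨h₁, ?_, fun S => ⟨fun Z hZ => ⟨graph_mem_PolG₂ hJω e S hZ, Z, hZ, rfl⟩,
    graph_injective.injOn, ?_⟩, ?_⟩
  · ext W
    rw [Set.mem_iUnion]
    exact ⟨fun ⟨_, hW⟩ => hW.1, fun hW => (h₁ W hW).imp fun S hS => ⟨hW, hS⟩⟩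
  · rintro _ ⟨-, Z, hZ, rfl⟩
    exact ⟨Z, hZ, rfl⟩
  · rintro S T Z hZ ⟨-, Y, hY, hZY⟩
    have hpos : 0 < 1 + ‖Y‖ := by positivity
    -- This radius is the threshold for the transversality estimate, with `Y` the operator
    -- representing `graph Z` over `W_T`.
    refine ⟨ENNReal.ofReal (1 + ‖Y‖)⁻¹, ENNReal.ofReal_pos.2 (inv_pos.2 hpos), fun Z' hZ' hlt => ?_⟩
    have hW := graph_mem_PolG₂ hJω e S hZ'
    refine ⟨hW, exists_mem_B₂α_eq_graph hJω e T hW (graph_inf_WS_orthogonal_eq_bot e hZY ?_)⟩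
    have h := (enorm_le_hsNorm (Z' - Z)).trans_lt hlt
    rw [← ofReal_norm, ENNReal.ofReal_lt_ofReal_iff (inv_pos.2 hpos)] at h
    calc (1 + ‖Y‖) * ‖Z' - Z‖ < (1 + ‖Y‖) * (1 + ‖Y‖)⁻¹ := by gcongr
      _ = 1 := mul_inv_cancel₀ hpos.ne'
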